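/- **Definitions.** A *2-polygraph* $\Sigma$ consists of a set $\Sigma_0$ of 0-cells, a directed graph $\Sigma_1$ of 1-cells on $\Sigma_0$, and a family $\Sigma_2$ of 2-cells $\alpha : f\Rightarrow g$, where $f,g$ are parallel 1-cells (paths) of the free category $\Sigma_1^*$ on this graph. It is *finite* if it has finitely many cells in each dimension. (A 2-polygraph with exactly one 0-cell is a word rewriting system.) Let $\Sigma^*$ be the strict 2-category freely generated by $\Sigma$, and let $\Sigma^\top$ be the free track 2-category on $\Sigma$, i.e. the strict 2-category obtained from $\Sigma_1^*$ by freely adjoining the 2-cells of $\Sigma_2$ together with inverses for $\star_1$ (the composition of 2-cells along 1-cells). A 1-cell $f$ of $\Sigma^*$ *reduces* into $g$ if there is a non-identity 2-cell $f\Rightarrow g$ in $\Sigma^*$. The 2-polygraph $\Sigma$ is *convergent* if it terminates (there is no infinite sequence $f_0,f_1,f_2,\dots$ of 1-cells such that each $f_k$ reduces into $f_{k+1}$) and is confluent (for all 2-cells $A:f\Rightarrow g$ and $B:f\Rightarrow h$ of $\Sigma^*$ there are 2-cells $g\Rightarrow k$ and $h\Rightarrow k$ of $\Sigma^*$ with a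 common target $k$). A *2-sphere* of a 2-category $\mathcal C$ is a pair of parallel 2-cells. For a set $\Gamma$ of 2-spheres of $\mathcal C$, let $\mathcal C(\Gamma)$ be the track 3-category obtained from $\mathcal C$ by freely adjoining, for each $(A,B)\in\Gamma$, an invertible 3-cell from $A$ to $B$. The set $\Gamma$ is a *homotopy basis* of $\mathcal C$ if, for every 2-sphere $(A,B)$ of $\mathcal C$, there is a 3-cell from $A$ to $B$ in $\mathcal C(\Gamma)$. A 2-polygraph $\Sigma$ has *finite derivation type* if it is finite and $\Sigma^\top$ admits a finite homotopy basis. **Corollary (Squier).** Every finite convergent 2-polygraph has finite derivation type. -/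

import Mathlib

open CategoryTheory

universe u v w

/-! ### Adjoining 2-cells to a free category

`V` is a 1-polygraph (a directed graph, i.e. a quiver), the 1-cells of the free category on it are the
paths `Quiver.Path p q`, composed by `Quiver.Path.comp`. -/

/-- Formal composites of 2-cells over the free category on the graph `V`, generated by a family `G` of
generating 2-cells. The formal composites are closed under identities, the composition `⋆₁` (`vcomp`) and
the composition `⋆₀` of a 2-cell with a 1-cell on either side (`whiskerLeft`, `whiskerRight`). As usual,
the composite `A ⋆₀ B` of `A : f ⇒ g` and `B : h ⇒ k` is `(A ⋆₀ h) ⋆₁ (g ⋆₀ B)`. -/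
inductive FormalTwoCell {V : Type u} [Quiver.{v} V]
    (G : ∀ ⦃p q : V⦄, Quiver.Path p q → Quiver.Path p q → Type w) :
    ∀ {p q : V}, Quiver.Path p q → Quiver.Path p q → Type (max u v w)
  | gen {p q : V} {f g : Quiver.Path p q} (α : G f g) : FormalTwoCell G f g
  | id {p q : V} (f : Quiver.Path p q) : FormalTwoCell G f f
  | vcomp {p q : V} {f g h : Quiver.Path p q} (A : FormalTwoCell G f g) (B : FormalTwoCell G g h) :
      FormalTwoCell G f h
  | whiskerLeft {p q r : V} (f : Quiver.Path p q) {g h : Quiver.Path q r} (A : FormalTwoCell G g h) :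
      FormalTwoCell G (f.comp g) (f.comp h)
  | whiskerRight {p q r : V} {f g : Quiver.Path p q} (A : FormalTwoCell G f g) (h : Quiver.Path q r) :
      FormalTwoCell G (f.comp h) (g.comp h)

namespace FormalTwoCell

variable {V : Type u} [Quiver.{v} V] {G : ∀ ⦃p q : V⦄, Quiver.Path p q → Quiver.Path p q → Type w}

/-- Transport of a formal composite along equalities of its source and target. -/
def cast {p q : V} {f f' g g' : Quiver.Path p q} (hf : f = f') (hg : g = g')
    (A : FormalTwoCell G f g) : FormalTwoCell G f' g' :=
  hg ▸ hf ▸ A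

/-- The congruence on formal composites generated by the axioms of strict 2-categories and by a given
family `R` of relations between parallel formal composites. -/
inductive Rel (R : ∀ ⦃p q : V⦄ ⦃f g : Quiver.Path p q⦄,
      FormalTwoCell G f g → FormalTwoCell G f g → Prop) :
    ∀ {p q : V} {f g : Quiver.Path p q}, FormalTwoCell G f g → FormalTwoCell G f g → Prop
  | of {p q : V} {f g : Quiver.Path p q} {A B : FormalTwoCell G f g} (h : R A B) : Rel R A B
  | refl {p q : V} {f g : Quiver.Path p q} (A : FormalTwoCell G f g) : Rel R A A
  | symm {p q : V} {f g : Quiver.Path p q} {A B : FormalTwoCell G f g} (h : Rel R A B) : Rel R B A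
  | trans {p q : V} {f g : Quiver.Path p q} {A B C : FormalTwoCell G f g} (h : Rel R A B)
      (h' : Rel R B C) : Rel R A C
  | vcomp_congr {p q : V} {f g h : Quiver.Path p q} {A A' : FormalTwoCell G f g}
      {B B' : FormalTwoCell G g h} (hA : Rel R A A') (hB : Rel R B B') :
      Rel R (A.vcomp B) (A'.vcomp B')
  | whiskerLeft_congr {p q r : V} (f : Quiver.Path p q) {g h : Quiver.Path q r}
      {A B : FormalTwoCell G g h} (hAB : Rel R A B) : Rel R (A.whiskerLeft f) (B.whiskerLeft f)
  | whiskerRight_congr {p q r : V} {f g : Quiver.Path p q} {A B : FormalTwoCell G f g}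
      (hAB : Rel R A B) (h : Quiver.Path q r) : Rel R (A.whiskerRight h) (B.whiskerRight h)
  | id_vcomp {p q : V} {f g : Quiver.Path p q} (A : FormalTwoCell G f g) :
      Rel R ((FormalTwoCell.id f).vcomp A) A
  | vcomp_id {p q : V} {f g : Quiver.Path p q} (A : FormalTwoCell G f g) :
      Rel R (A.vcomp (FormalTwoCell.id g)) A
  | vcomp_assoc {p q : V} {f g h k : Quiver.Path p q} (A : FormalTwoCell G f g)
      (B : FormalTwoCell G g h) (C : FormalTwoCell G h k) :
      Rel R ((A.vcomp B).vcomp C) (A.vcomp (B.vcomp C))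
  | whiskerLeft_id {p q r : V} (f : Quiver.Path p q) (g : Quiver.Path q r) :
      Rel R ((FormalTwoCell.id g).whiskerLeft f) (FormalTwoCell.id (f.comp g))
  | whiskerLeft_vcomp {p q r : V} (f : Quiver.Path p q) {g h k : Quiver.Path q r}
      (A : FormalTwoCell G g h) (B : FormalTwoCell G h k) :
      Rel R ((A.vcomp B).whiskerLeft f) ((A.whiskerLeft f).vcomp (B.whiskerLeft f))
  | id_whiskerRight {p q r : V} (f : Quiver.Path p q) (g : Quiver.Path q r) :
      Rel R ((FormalTwoCell.id f).whiskerRight g) (FormalTwoCell.id (f.comp g))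
  | vcomp_whiskerRight {p q r : V} {f g h : Quiver.Path p q} (A : FormalTwoCell G f g)
      (B : FormalTwoCell G g h) (k : Quiver.Path q r) :
      Rel R ((A.vcomp B).whiskerRight k) ((A.whiskerRight k).vcomp (B.whiskerRight k))
  | nil_whiskerLeft {p q : V} {f g : Quiver.Path p q} (A : FormalTwoCell G f g) :
      Rel R (A.whiskerLeft Quiver.Path.nil) (A.cast f.nil_comp.symm g.nil_comp.symm)
  | whiskerRight_nil {p q : V} {f g : Quiver.Path p q} (A : FormalTwoCell G f g) :
      Rel R (A.whiskerRight Quiver.Path.nil) (A.cast f.comp_nil.symm g.comp_nil.symm)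
  | comp_whiskerLeft {p q r s : V} (f : Quiver.Path p q) (g : Quiver.Path q r)
      {h k : Quiver.Path r s} (A : FormalTwoCell G h k) :
      Rel R (A.whiskerLeft (f.comp g))
        (((A.whiskerLeft g).whiskerLeft f).cast (f.comp_assoc g h).symm (f.comp_assoc g k).symm)
  | whiskerRight_comp {p q r s : V} {f g : Quiver.Path p q} (A : FormalTwoCell G f g)
      (h : Quiver.Path q r) (k : Quiver.Path r s) :
      Rel R (A.whiskerRight (h.comp k))
        (((A.whiskerRight h).whiskerRight k).cast (f.comp_assoc h k) (g.comp_assoc h k))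
  | whisker_assoc {p q r s : V} (f : Quiver.Path p q) {g h : Quiver.Path q r}
      (A : FormalTwoCell G g h) (k : Quiver.Path r s) :
      Rel R ((A.whiskerLeft f).whiskerRight k)
        (((A.whiskerRight k).whiskerLeft f).cast (f.comp_assoc g k).symm (f.comp_assoc h k).symm)
  | whisker_exchange {p q r : V} {f g : Quiver.Path p q} {h k : Quiver.Path q r}
      (A : FormalTwoCell G f g) (B : FormalTwoCell G h k) :
      Rel R ((B.whiskerLeft f).vcomp (A.whiskerRight k)) ((A.whiskerRight h).vcomp (B.whiskerLeft g))

/-- Equality modulo the congruence `Rel R`, as a setoid. -/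
def setoid (R : ∀ ⦃p q : V⦄ ⦃f g : Quiver.Path p q⦄,
      FormalTwoCell G f g → FormalTwoCell G f g → Prop) {p q : V} (f g : Quiver.Path p q) :
    Setoid (FormalTwoCell G f g) where
  r := Rel R
  iseqv := ⟨Rel.refl, Rel.symm, Rel.trans⟩

end FormalTwoCell

/-- The strict 2-category obtained from the free category on the graph `V` by adjoining the generating
2-cells `G` and collapsing the relations `R` between 2-cells. This type is its set of 0-cells. -/
def PresentedTwoCat {V : Type u} [Quiver.{v} V]
    (G : ∀ ⦃p q : V⦄, Quiver.Path p q → Quiver.Path p q → Type w)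
    (_R : ∀ ⦃p q : V⦄ ⦃f g : Quiver.Path p q⦄,
      FormalTwoCell G f g → FormalTwoCell G f g → Prop) : Type u :=
  V

namespace PresentedTwoCat

variable {V : Type u} [Quiver.{v} V] {G : ∀ ⦃p q : V⦄, Quiver.Path p q → Quiver.Path p q → Type w}
  {R : ∀ ⦃p q : V⦄ ⦃f g : Quiver.Path p q⦄, FormalTwoCell G f g → FormalTwoCell G f g → Prop}

/-- The 1-cells are those of the free category on `V`. -/
instance : CategoryStruct.{max u v} (PresentedTwoCat G R) where
  Hom p q := @Quiver.Path V _ p q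
  id p := @Quiver.Path.nil V _ p
  comp f g := Quiver.Path.comp f g

/-- The 2-cells are the formal composites modulo the congruence `Rel R`. -/
instance (p q : PresentedTwoCat G R) : Category.{max u v w} (p ⟶ q) where
  Hom f g := Quotient (FormalTwoCell.setoid R (V := V) (p := p) (q := q) f g)
  id f := Quotient.mk _ (FormalTwoCell.id (V := V) (p := p) (q := q) f)
  comp A B := Quotient.map₂ FormalTwoCell.vcomp
    (fun _ _ hA _ _ hB => FormalTwoCell.Rel.vcomp_congr hA hB) A B
  id_comp := by rintro _ _ ⟨A⟩; exact Quotient.sound (FormalTwoCell.Rel.id_vcomp A)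
  comp_id := by rintro _ _ ⟨A⟩; exact Quotient.sound (FormalTwoCell.Rel.vcomp_id A)
  assoc := by
    rintro _ _ _ _ ⟨A⟩ ⟨B⟩ ⟨C⟩; exact Quotient.sound (FormalTwoCell.Rel.vcomp_assoc A B C)

/-- The 2-cell represented by a formal composite. -/
def mk {p q : PresentedTwoCat G R} {f g : p ⟶ q}
    (A : FormalTwoCell (V := V) G (p := p) (q := q) f g) : f ⟶ g :=
  Quotient.mk _ A

theorem sound {p q : PresentedTwoCat G R} {f g : p ⟶ q}
    {A B : FormalTwoCell (V := V) G (p := p) (q := q) f g} (h : FormalTwoCell.Rel R A B) :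
    (mk A : f ⟶ g) = mk B :=
  Quotient.sound h

theorem mk_cast {p q : PresentedTwoCat G R} {f f' g g' : p ⟶ q} (hf : f = f') (hg : g = g')
    (A : FormalTwoCell (V := V) G (p := p) (q := q) f g) :
    (mk (A.cast hf hg) : f' ⟶ g') = eqToHom hf.symm ≫ mk A ≫ eqToHom hg := by
  subst hf; subst hg
  simp [FormalTwoCell.cast]

theorem comp_assoc' {p q r s : PresentedTwoCat G R} (f : p ⟶ q) (g : q ⟶ r) (h : r ⟶ s) :
    (f ≫ g) ≫ h = f ≫ g ≫ h :=
  Quiver.Path.comp_assoc (V := V) f g h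

theorem id_comp' {p q : PresentedTwoCat G R} (f : p ⟶ q) : 𝟙 p ≫ f = f :=
  Quiver.Path.nil_comp (V := V) f

theorem comp_id' {p q : PresentedTwoCat G R} (f : p ⟶ q) : f ≫ 𝟙 q = f :=
  Quiver.Path.comp_nil (V := V) f

/-- Left whiskering of a 2-cell by a 1-cell. -/
def wl {p q r : PresentedTwoCat G R} (f : p ⟶ q) {g h : q ⟶ r} (A : g ⟶ h) : f ≫ g ⟶ f ≫ h :=
  Quotient.map (FormalTwoCell.whiskerLeft (V := V) f)
    (fun _ _ hA => FormalTwoCell.Rel.whiskerLeft_congr f hA) A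

/-- Right whiskering of a 2-cell by a 1-cell. -/
def wr {p q r : PresentedTwoCat G R} {f g : p ⟶ q} (A : f ⟶ g) (h : q ⟶ r) : f ≫ h ⟶ g ≫ h :=
  Quotient.map (fun A => FormalTwoCell.whiskerRight (V := V) A h)
    (fun _ _ hA => FormalTwoCell.Rel.whiskerRight_congr hA h) A

theorem wl_id {p q r : PresentedTwoCat G R} (f : p ⟶ q) (g : q ⟶ r) :
    wl f (𝟙 g) = 𝟙 (f ≫ g) :=
  sound (FormalTwoCell.Rel.whiskerLeft_id (V := V) f g)

theorem wr_id {p q r : PresentedTwoCat G R} (f : p ⟶ q) (g : q ⟶ r) :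
    wr (𝟙 f) g = 𝟙 (f ≫ g) :=
  sound (FormalTwoCell.Rel.id_whiskerRight (V := V) f g)

theorem wl_eqToHom {p q r : PresentedTwoCat G R} (f : p ⟶ q) {g h : q ⟶ r} (e : g = h) :
    wl f (eqToHom e) = eqToHom (by rw [e]) := by
  subst e; exact wl_id f g

theorem wr_eqToHom {p q r : PresentedTwoCat G R} {f g : p ⟶ q} (e : f = g) (h : q ⟶ r) :
    wr (eqToHom e) h = eqToHom (by rw [e]) := by
  subst e; exact wr_id f h

/-- The strict 2-category structure: the coherence isomorphisms are equalities. -/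
instance : Bicategory.{max u v w, max u v} (PresentedTwoCat G R) where
  whiskerLeft f _ _ A := wl f A
  whiskerRight A h := wr A h
  associator f g h := eqToIso (comp_assoc' f g h)
  leftUnitor f := eqToIso (id_comp' f)
  rightUnitor f := eqToIso (comp_id' f)
  whiskerLeft_id := wl_id
  whiskerLeft_comp := by
    rintro _ _ _ f _ _ _ ⟨A⟩ ⟨B⟩; exact sound (FormalTwoCell.Rel.whiskerLeft_vcomp (V := V) f A B)
  id_whiskerLeft := by
    rintro _ _ f g ⟨A⟩
    exact (sound (FormalTwoCell.Rel.nil_whiskerLeft (V := V) A)).trans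
      (mk_cast (id_comp' f).symm (id_comp' g).symm A)
  comp_whiskerLeft := by
    rintro _ _ _ _ f g h k ⟨A⟩
    exact (sound (FormalTwoCell.Rel.comp_whiskerLeft (V := V) f g A)).trans
      (mk_cast (comp_assoc' f g h).symm (comp_assoc' f g k).symm _)
  id_whiskerRight := wr_id
  comp_whiskerRight := by
    rintro _ _ _ _ _ _ ⟨A⟩ ⟨B⟩ k; exact sound (FormalTwoCell.Rel.vcomp_whiskerRight (V := V) A B k)
  whiskerRight_id := by
    rintro _ _ f g ⟨A⟩
    exact (sound (FormalTwoCell.Rel.whiskerRight_nil (V := V) A)).trans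
      (mk_cast (comp_id' f).symm (comp_id' g).symm A)
  whiskerRight_comp := by
    rintro _ _ _ _ f g ⟨A⟩ h k
    exact (sound (FormalTwoCell.Rel.whiskerRight_comp (V := V) A h k)).trans
      (mk_cast (comp_assoc' f h k) (comp_assoc' g h k) _)
  whisker_assoc := by
    rintro _ _ _ _ f g h ⟨A⟩ k
    exact (sound (FormalTwoCell.Rel.whisker_assoc (V := V) f A k)).trans
      (mk_cast (comp_assoc' f g k).symm (comp_assoc' f h k).symm _)
  whisker_exchange := by
    rintro _ _ _ _ _ _ _ ⟨A⟩ ⟨B⟩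
    exact sound (FormalTwoCell.Rel.whisker_exchange (V := V) A B)
  pentagon f g h i := by simp [wl_eqToHom, wr_eqToHom]
  triangle f g := by simp [wl_eqToHom, wr_eqToHom]

instance : Bicategory.Strict (PresentedTwoCat G R) where
  id_comp := id_comp'
  comp_id := comp_id'
  assoc := comp_assoc'
  leftUnitor_eqToIso _ := rfl
  rightUnitor_eqToIso _ := rfl
  associator_eqToIso _ _ _ := rfl

end PresentedTwoCat

/-! ### Homotopy bases of 2-categories -/

/-- A 2-sphere: a pair `(A, B)` of parallel 2-cells. -/
structure TwoSphere (C : Type u) [Bicategory.{w, v} C] where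
  {p q : C}
  {f g : p ⟶ q}
  A : f ⟶ g
  B : f ⟶ g

open Bicategory in
/-- Formal composites of 3-cells over the strict 2-category `C`, generated by a 3-cell `γ : A ⇛ B` and a
formal inverse `γ⁻¹ : B ⇛ A` for every 2-sphere `γ = (A, B)` in `Γ`; they are closed under identities, the
compositions `⋆₂` and `⋆₁`, and the composition `⋆₀` with 1-cells on either side (the general `⋆₀` is
composed of these). The 3-cells of the track 3-category `C(Γ)` are the classes of such formal composites
modulo the axioms of strict 3-categories and the inversion relations; as those relations only relate
parallel formal composites, a 3-cell from `A` to `B` exists if and only if a formal composite does. -/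
inductive FormalThreeCell {C : Type u} [Bicategory.{w, v} C] (Γ : Set (TwoSphere C)) :
    ∀ {p q : C} {f g : p ⟶ q}, (f ⟶ g) → (f ⟶ g) → Type (max u v w)
  | gen (γ : TwoSphere C) (hγ : γ ∈ Γ) : FormalThreeCell Γ γ.A γ.B
  | genInv (γ : TwoSphere C) (hγ : γ ∈ Γ) : FormalThreeCell Γ γ.B γ.A
  | id {p q : C} {f g : p ⟶ q} (A : f ⟶ g) : FormalThreeCell Γ A A
  | comp₂ {p q : C} {f g : p ⟶ q} {A B D : f ⟶ g} (X : FormalThreeCell Γ A B)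
      (Y : FormalThreeCell Γ B D) : FormalThreeCell Γ A D
  | comp₁ {p q : C} {f g h : p ⟶ q} {A A' : f ⟶ g} {B B' : g ⟶ h} (X : FormalThreeCell Γ A A')
      (Y : FormalThreeCell Γ B B') : FormalThreeCell Γ (A ≫ B) (A' ≫ B')
  | whiskerLeft {p q r : C} (f : p ⟶ q) {g h : q ⟶ r} {A B : g ⟶ h} (X : FormalThreeCell Γ A B) :
      FormalThreeCell Γ (f ◁ A) (f ◁ B)
  | whiskerRight {p q r : C} {f g : p ⟶ q} {A B : f ⟶ g} (X : FormalThreeCell Γ A B) (h : q ⟶ r) :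
      FormalThreeCell Γ (A ▷ h) (B ▷ h)

/-- The homotopy relation `≈_Γ` on the 2-cells of `C` generated by the set `Γ` of 2-spheres. -/
def Homotopic {C : Type u} [Bicategory.{w, v} C] (Γ : Set (TwoSphere C)) {p q : C} {f g : p ⟶ q}
    (A B : f ⟶ g) : Prop :=
  Nonempty (FormalThreeCell Γ A B)

/-- `Γ` is a homotopy basis of `C`: any two parallel 2-cells are related by `≈_Γ`. -/
def IsHomotopyBasis {C : Type u} [Bicategory.{w, v} C] (Γ : Set (TwoSphere C)) : Prop :=
  ∀ γ : TwoSphere C, Homotopic Γ γ.A γ.B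

/-! ### 2-polygraphs -/

/-- A 2-polygraph: a 1-polygraph (a set of 0-cells and a graph of 1-cells on it), with a family of
1-spheres (pairs of parallel 1-cells) of the free category on it; `cell₂ f g` is the set of 2-cells of the
polygraph with source `f` and target `g`. -/
structure TwoPolygraph where
  cell₀ : Type u
  [quiver : Quiver.{v} cell₀]
  cell₂ : ∀ ⦃p q : cell₀⦄, Quiver.Path p q → Quiver.Path p q → Type w

namespace TwoPolygraph

attribute [instance] TwoPolygraph.quiver

variable (S : TwoPolygraph.{u, v, w})

/-- A 2-polygraph is finite when it has finitely many cells in each dimension. -/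
structure IsFinite : Prop where
  finite_cell₀ : Finite S.cell₀
  finite_cell₁ : Finite (Σ p q : S.cell₀, p ⟶ q)
  finite_cell₂ : Finite (Σ (p q : S.cell₀) (f g : Quiver.Path p q), S.cell₂ f g)

/-- The 2-category `S*` freely generated by the 2-polygraph `S`. -/
abbrev Free : Type u :=
  PresentedTwoCat S.cell₂ (fun _ _ _ _ _ _ => False)

/-- The generating 2-cells of the free track 2-category: the 2-cells `α : f ⇒ g` of `S` and formal
inverses `α⁻¹ : g ⇒ f` of them. -/
inductive TrackGen ⦃p q : S.cell₀⦄ (f g : Quiver.Path p q) : Type w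
  | pos (α : S.cell₂ f g) : TrackGen f g
  | inv (α : S.cell₂ g f) : TrackGen f g

/-- The inversion relations `α ⋆₁ α⁻¹ = 1` and `α⁻¹ ⋆₁ α = 1`. -/
inductive TrackRel : ∀ ⦃p q : S.cell₀⦄ ⦃f g : Quiver.Path p q⦄,
    FormalTwoCell S.TrackGen f g → FormalTwoCell S.TrackGen f g → Prop
  | pos_inv {p q : S.cell₀} {f g : Quiver.Path p q} (α : S.cell₂ f g) :
      TrackRel (.vcomp (.gen (.pos α)) (.gen (.inv α))) (.id f)
  | inv_pos {p q : S.cell₀} {f g : Quiver.Path p q} (α : S.cell₂ f g) :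
      TrackRel (.vcomp (.gen (.inv α)) (.gen (.pos α))) (.id g)

/-- The track 2-category freely generated by the 2-polygraph `S`. -/
abbrev FreeTrack : Type u :=
  PresentedTwoCat S.TrackGen S.TrackRel

variable {S}

/-- A 2-cell is degenerate when it is an identity cell. -/
def IsDegenerate {p q : S.Free} {f g : p ⟶ q} (A : f ⟶ g) : Prop :=
  ∃ h : f = g, A = eqToHom h

/-- `f` reduces into `g`: there is a non-degenerate 2-cell from `f` to `g` in `S*`. -/
def Reduces {p q : S.Free} (f g : p ⟶ q) : Prop :=
  ∃ A : f ⟶ g, ¬ IsDegenerate A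

/-- There is no infinite reduction sequence starting at `f`. -/
def TerminatesAt {p q : S.Free} (f : p ⟶ q) : Prop :=
  ¬ ∃ F : ℕ → (p ⟶ q), F 0 = f ∧ ∀ k, Reduces (F k) (F (k + 1))

/-- Every branching `(A, B)` with source `f` can be completed by a confluence `(A', B')`. -/
def ConfluentAt {p q : S.Free} (f : p ⟶ q) : Prop :=
  ∀ ⦃g h : p ⟶ q⦄ (_A : f ⟶ g) (_B : f ⟶ h), ∃ k : p ⟶ q, Nonempty (g ⟶ k) ∧ Nonempty (h ⟶ k)

variable (S)

/-- A 2-polygraph is convergent when it terminates and is confluent at every 1-cell of `S*`. -/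
def IsConvergent : Prop :=
  ∀ (p q : S.Free) (f : p ⟶ q), TerminatesAt f ∧ ConfluentAt f

/-- Finite derivation type: `S` is finite and its free track 2-category has a finite homotopy basis. -/
def HasFiniteDerivationType : Prop :=
  S.IsFinite ∧ ∃ Γ : Set (TwoSphere S.FreeTrack), Γ.Finite ∧ IsHomotopyBasis Γ

end TwoPolygraph

/-!
Squier's theorem is proved by lifting Newman's lemma one dimension up.

A rewriting step `u α v` is a generating 2-cell `α` in a context of two 1-cells, and a 2-cell of the free
track 2-category is positive when it is a composite of steps. A finite set `Γ` of 2-spheres is chosen by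
completing every pair of steps whose common source has length at most `2 * L` by a confluence diagram, where
`L` bounds the length of the sources of the generating 2-cells (`exists_finite_joinable`). These are more
spheres than the critical branchings, but still finitely many, and no classification of branchings is
needed: two arbitrary steps with the same source either act on disjoint factors, so that the exchange law
fills their branching, or overlap, and then removing the common context leaves a source of length at most
`2 * L` (`Step.Joinable.of_short`). Hence `Γ` fills all local branchings.

By Noetherian induction, two positive 2-cells from a 1-cell to normal forms have the same target and are
homotopic (`IsConvergent.homotopic_of_isNormal`). It follows, by induction on the construction of a 2-cell
`A : f ⇒ g`, that `A` followed by a positive 2-cell from `g` to its normal form is homotopic to a positive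
2-cell (`IsConvergent.exists_isPositive_homotopic`). Two parallel 2-cells thus become homotopic after
composition with the same positive 2-cell, which can be cancelled, because 2-cells of a track 2-category are
invertible (`IsConvergent.isHomotopyBasis`).

The hypotheses speak about the free 2-category. They are transferred by counting generators, which shows
that a step is not an identity (`Step.reduces`), and by mapping 2-cells of the free 2-category to positive
2-cells (`exists_isPositive_of_formalTwoCell`).
-/

/-! ### Paths in a quiver -/

namespace Quiver.Path

variable {V : Type u} [Quiver.{v} V]

/-- Levi's lemma for paths: of two factorisations of the same path, one refines the other. -/
theorem exists_eq_comp_of_comp_eq_comp {a b c d : V} {p : Path a b} {q : Path b d} {p' : Path a c}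
    {q' : Path c d} (h : p.comp q = p'.comp q') (hl : p.length ≤ p'.length) :
    ∃ e : Path b c, p' = p.comp e ∧ q = e.comp q' := by
  induction q' with
  | nil => exact ⟨q, h.symm, rfl⟩
  | cons q' x ih =>
    cases q with
    | nil =>
      have := congrArg length h
      simp at this
      omega
    | cons q y =>
      simp only [comp_cons, cons.injEq] at h
      obtain ⟨rfl, h, hx⟩ := h
      obtain rfl := eq_of_heq hx
      obtain ⟨e, rfl, rfl⟩ := ih (eq_of_heq h)
      exact ⟨e, rfl, rfl⟩

/-- A finite quiver has finitely many paths of bounded length. -/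
theorem finite_setOf_length_le [Finite V] [∀ a b : V, Finite (a ⟶ b)] (a b : V) (n : ℕ) :
    {p : Path a b | p.length ≤ n}.Finite := by
  induction n generalizing b with
  | zero =>
    have := instSubsingletonBddPaths a b
    exact Set.toFinite (α := BoundedPaths a b 0) Set.univ |>.image (fun p => p.1) |>.subset
      fun p hp => ⟨⟨p, hp⟩, trivial, rfl⟩
  | succ n ih =>
    refine ((ih b).union (Set.finite_iUnion fun c =>
      Set.Finite.image2 (fun (p : Path a c) (x : c ⟶ b) => p.cons x) (ih c) Set.finite_univ)).subset ?_
    rintro (_ | ⟨p, x⟩) hp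
    · exact Or.inl (Nat.zero_le _)
    · exact Or.inr (Set.mem_iUnion.2 ⟨_, p, Nat.le_of_succ_le_succ hp, x, trivial, rfl⟩)

end Quiver.Path

/-! ### Counting generators in a 2-cell of the free 2-category -/

namespace FormalTwoCell

variable {V : Type u} [Quiver.{v} V] {G : ∀ ⦃p q : V⦄, Quiver.Path p q → Quiver.Path p q → Type w}

/-- The number of occurrences of generators in a formal composite. -/
def size : ∀ {p q : V} {f g : Quiver.Path p q}, FormalTwoCell G f g → ℕ
  | _, _, _, _, gen _ => 1
  | _, _, _, _, id _ => 0
  | _, _, _, _, vcomp A B => A.size + B.size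
  | _, _, _, _, whiskerLeft _ A => A.size
  | _, _, _, _, whiskerRight A _ => A.size

@[simp]
theorem size_cast {p q : V} {f f' g g' : Quiver.Path p q} (hf : f = f') (hg : g = g')
    (A : FormalTwoCell G f g) : (A.cast hf hg).size = A.size := by
  subst hf; subst hg; rfl

/-- The axioms of strict 2-categories preserve the number of generators. -/
theorem Rel.size_eq {p q : V} {f g : Quiver.Path p q} {A B : FormalTwoCell G f g}
    (h : Rel (fun _ _ _ _ _ _ => False) A B) : A.size = B.size := by
  induction h with
  | of h => exact h.elim
  | refl A => rfl
  | symm _ ih => exact ih.symm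
  | trans _ _ ih ih' => exact ih.trans ih'
  | _ => simp only [size, size_cast] at *; try omega

end FormalTwoCell

namespace TwoPolygraph

variable {S : TwoPolygraph.{u, v, w}}

theorem IsDegenerate.size_eq_zero {p q : S.Free} {f g : p ⟶ q}
    {A : FormalTwoCell (V := S.cell₀) S.cell₂ (p := p) (q := q) f g}
    (h : IsDegenerate (PresentedTwoCat.mk A : f ⟶ g)) : A.size = 0 := by
  obtain ⟨rfl, h⟩ := h
  exact (FormalTwoCell.Rel.size_eq (Quotient.exact h)).trans rfl

end TwoPolygraph

open Bicategory PresentedTwoCat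

/-! ### The homotopy relation as a congruence -/

namespace Homotopic

variable {C : Type u} [Bicategory.{w, v} C] {Γ : Set (TwoSphere C)}

theorem refl {p q : C} {f g : p ⟶ q} (A : f ⟶ g) : Homotopic Γ A A := ⟨.id A⟩

theorem of_eq {p q : C} {f g : p ⟶ q} {A B : f ⟶ g} (h : A = B) : Homotopic Γ A B := h ▸ refl A

theorem trans {p q : C} {f g : p ⟶ q} {A B D : f ⟶ g} (h : Homotopic Γ A B)
    (h' : Homotopic Γ B D) : Homotopic Γ A D :=
  let ⟨X⟩ := h; let ⟨Y⟩ := h'; ⟨.comp₂ X Y⟩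

theorem comp {p q : C} {f g h : p ⟶ q} {A A' : f ⟶ g} {B B' : g ⟶ h} (hA : Homotopic Γ A A')
    (hB : Homotopic Γ B B') : Homotopic Γ (A ≫ B) (A' ≫ B') :=
  let ⟨X⟩ := hA; let ⟨Y⟩ := hB; ⟨.comp₁ X Y⟩

theorem whiskerLeft {p q r : C} (f : p ⟶ q) {g h : q ⟶ r} {A B : g ⟶ h} (hAB : Homotopic Γ A B) :
    Homotopic Γ (f ◁ A) (f ◁ B) :=
  let ⟨X⟩ := hAB; ⟨.whiskerLeft f X⟩

theorem whiskerRight {p q r : C} {f g : p ⟶ q} {A B : f ⟶ g} (hAB : Homotopic Γ A B) (h : q ⟶ r) :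
    Homotopic Γ (A ▷ h) (B ▷ h) :=
  let ⟨X⟩ := hAB; ⟨.whiskerRight X h⟩

theorem symm {p q : C} {f g : p ⟶ q} {A B : f ⟶ g} (h : Homotopic Γ A B) : Homotopic Γ B A := by
  obtain ⟨X⟩ := h
  induction X with
  | gen γ hγ => exact ⟨.genInv γ hγ⟩
  | genInv γ hγ => exact ⟨.gen γ hγ⟩
  | id A => exact refl A
  | comp₂ _ _ hX hY => exact hY.trans hX
  | comp₁ _ _ hX hY => exact hX.comp hY
  | whiskerLeft f _ hX => exact hX.whiskerLeft f
  | whiskerRight _ h hX => exact hX.whiskerRight h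

end Homotopic

namespace TwoPolygraph

variable {S : TwoPolygraph.{u, v, w}}

/-! ### Rewriting steps -/

/-- A rewriting step `u α v` : a generating 2-cell `α : s ⇒ t` in the context of 1-cells `u` and `v`. -/
structure Step (S : TwoPolygraph.{u, v, w}) (x y : S.FreeTrack) where
  {p q : S.FreeTrack}
  u : x ⟶ p
  {s t : p ⟶ q}
  α : S.cell₂ s t
  v : q ⟶ y

namespace Step

variable {x y z : S.FreeTrack}

/-- The source of a step. -/
abbrev src (d : Step S x y) : x ⟶ y := d.u ≫ d.s ≫ d.v

/-- The target of a step. -/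
abbrev tgt (d : Step S x y) : x ⟶ y := d.u ≫ d.t ≫ d.v

/-- The generating 2-cell `α` as a 2-cell of the free track 2-category. -/
def genCell {p q : S.FreeTrack} {s t : p ⟶ q} (α : S.cell₂ s t) : s ⟶ t :=
  PresentedTwoCat.mk (.gen (.pos α))

/-- The formal inverse of `α` as a 2-cell of the free track 2-category. -/
def genInvCell {p q : S.FreeTrack} {s t : p ⟶ q} (α : S.cell₂ s t) : t ⟶ s :=
  PresentedTwoCat.mk (.gen (.inv α))

theorem genCell_comp_genInvCell {p q : S.FreeTrack} {s t : p ⟶ q} (α : S.cell₂ s t) :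
    genCell α ≫ genInvCell α = 𝟙 s :=
  sound (.of (.pos_inv α))

theorem genInvCell_comp_genCell {p q : S.FreeTrack} {s t : p ⟶ q} (α : S.cell₂ s t) :
    genInvCell α ≫ genCell α = 𝟙 t :=
  sound (.of (.inv_pos α))

instance {p q : S.FreeTrack} {s t : p ⟶ q} (α : S.cell₂ s t) : IsIso (genCell α) :=
  ⟨genInvCell α, genCell_comp_genInvCell α, genInvCell_comp_genCell α⟩

/-- The 2-cell of the free track 2-category given by a step. -/
def cell (d : Step S x y) : d.src ⟶ d.tgt := d.u ◁ (genCell d.α ▷ d.v)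

instance (d : Step S x y) : IsIso d.cell := by unfold cell; infer_instance

/-- Extension of the left context of a step. -/
def wl (w : z ⟶ x) (d : Step S x y) : Step S z y := ⟨w ≫ d.u, d.α, d.v⟩

/-- Extension of the right context of a step. -/
def wr (d : Step S x y) (w : y ⟶ z) : Step S x z := ⟨d.u, d.α, d.v ≫ w⟩

theorem src_wl (w : z ⟶ x) (d : Step S x y) : (d.wl w).src = w ≫ d.src := comp_assoc' _ _ _

theorem tgt_wl (w : z ⟶ x) (d : Step S x y) : (d.wl w).tgt = w ≫ d.tgt := comp_assoc' _ _ _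

theorem src_wr (d : Step S x y) (w : y ⟶ z) : (d.wr w).src = d.src ≫ w := by
  simp only [src, wr, comp_assoc']

theorem tgt_wr (d : Step S x y) (w : y ⟶ z) : (d.wr w).tgt = d.tgt ≫ w := by
  simp only [tgt, wr, comp_assoc']

theorem cell_wl (w : z ⟶ x) (d : Step S x y) :
    (d.wl w).cell = eqToHom (d.src_wl w) ≫ w ◁ d.cell ≫ eqToHom (d.tgt_wl w).symm := by
  change (w ≫ d.u) ◁ (genCell d.α ▷ d.v) = _
  simp [cell, Strict.associator_eqToIso]
  rfl

theorem cell_wr (d : Step S x y) (w : y ⟶ z) :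
    (d.wr w).cell = eqToHom (d.src_wr w) ≫ d.cell ▷ w ≫ eqToHom (d.tgt_wr w).symm := by
  change d.u ◁ (genCell d.α ▷ (d.v ≫ w)) = _
  simp [cell, Strict.associator_eqToIso, whiskerLeft_eqToHom]
  rfl

end Step

/-! ### Positive 2-cells -/

/-- A 2-cell of the free track 2-category is positive when it is a composite of rewriting steps. -/
inductive IsPositive : ∀ {x y : S.FreeTrack} {f g : x ⟶ y}, (f ⟶ g) → Prop
  | id {x y : S.FreeTrack} (f : x ⟶ y) : IsPositive (𝟙 f)
  | step_comp {x y : S.FreeTrack} (d : Step S x y) {g : x ⟶ y} {A : d.tgt ⟶ g} (hA : IsPositive A) :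
      IsPositive (d.cell ≫ A)

namespace IsPositive

variable {x y z : S.FreeTrack} {f g h : x ⟶ y}

theorem eqToHom (e : f = g) : IsPositive (S := S) (CategoryTheory.eqToHom e) := by
  subst e; exact .id f

theorem comp {A : f ⟶ g} {B : g ⟶ h} (hA : IsPositive A) (hB : IsPositive B) :
    IsPositive (A ≫ B) := by
  induction hA with
  | id => simpa using hB
  | step_comp d _ ih => rw [Category.assoc]; exact (ih hB).step_comp d

theorem step (d : Step S x y) : IsPositive d.cell := by
  simpa using (IsPositive.id d.tgt).step_comp d

theorem isIso {A : f ⟶ g} (hA : IsPositive A) : IsIso A := by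
  induction hA with
  | id => infer_instance
  | step_comp d _ ih => infer_instance

theorem whiskerLeft (w : z ⟶ x) {A : f ⟶ g} (hA : IsPositive A) : IsPositive (w ◁ A) := by
  induction hA with
  | id f => rw [whiskerLeft_id]; exact .id _
  | step_comp d _ ih =>
    have : w ◁ d.cell = CategoryTheory.eqToHom (d.src_wl w).symm ≫ (d.wl w).cell ≫
        CategoryTheory.eqToHom (d.tgt_wl w) := by simp [Step.cell_wl]
    rw [whiskerLeft_comp, this]
    exact ((eqToHom _).comp ((step _).comp (eqToHom _))).comp ih

theorem whiskerRight {A : f ⟶ g} (hA : IsPositive A) (w : y ⟶ z) : IsPositive (A ▷ w) := by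
  induction hA with
  | id f => rw [id_whiskerRight]; exact .id _
  | step_comp d _ ih =>
    have : d.cell ▷ w = CategoryTheory.eqToHom (d.src_wr w).symm ≫ (d.wr w).cell ≫
        CategoryTheory.eqToHom (d.tgt_wr w) := by simp [Step.cell_wr]
    rw [comp_whiskerRight, this]
    exact ((eqToHom _).comp ((step _).comp (eqToHom _))).comp ih

/-- A generating 2-cell is a step with identity context. -/
theorem genCell {s t : x ⟶ y} (α : S.cell₂ s t) : IsPositive (Step.genCell α) := by
  have : Step.genCell α = CategoryTheory.eqToHom ((id_comp' _).trans (comp_id' _)).symm ≫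
      (⟨𝟙 x, α, 𝟙 y⟩ : Step S x y).cell ≫
        CategoryTheory.eqToHom ((id_comp' _).trans (comp_id' _)) := by
    simp [Step.cell, Strict.leftUnitor_eqToIso, Strict.rightUnitor_eqToIso]
  rw [this]
  exact (eqToHom _).comp ((step _).comp (eqToHom _))

theorem exists_step_or_eq {A : f ⟶ g} (hA : IsPositive A) :
    (∃ e : f = g, A = CategoryTheory.eqToHom e) ∨
      ∃ (d : Step S x y) (e : f = d.src) (B : d.tgt ⟶ g), IsPositive B ∧
        A = CategoryTheory.eqToHom e ≫ d.cell ≫ B := by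
  cases hA with
  | id => exact .inl ⟨rfl, rfl⟩
  | step_comp d hB => exact .inr ⟨d, rfl, _, hB, by simp⟩

end IsPositive

/-! ### Transfer between the free 2-category and the free track 2-category -/

/-- Every 2-cell of the free 2-category has a positive counterpart in the free track 2-category. -/
theorem exists_isPositive_of_formalTwoCell {x y : S.FreeTrack} {f g : x ⟶ y}
    (A : FormalTwoCell (V := S.cell₀) S.cell₂ (p := x) (q := y) f g) :
    ∃ B : f ⟶ g, IsPositive B := by
  induction A with
  | gen α => exact ⟨_, IsPositive.genCell α⟩
  | id f => exact ⟨_, IsPositive.id _⟩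
  | vcomp _ _ hA hB =>
    obtain ⟨A, hA⟩ := hA
    obtain ⟨B, hB⟩ := hB
    exact ⟨_, hA.comp hB⟩
  | whiskerLeft f _ hA =>
    obtain ⟨A, hA⟩ := hA
    exact ⟨_, hA.whiskerLeft (S := S) f⟩
  | whiskerRight _ h hA =>
    obtain ⟨A, hA⟩ := hA
    exact ⟨_, hA.whiskerRight (S := S) h⟩

/-- A step is a non-degenerate 2-cell of the free 2-category. -/
theorem Step.reduces {x y : S.FreeTrack} (d : Step S x y) :
    Reduces (S := S) (p := x) (q := y) d.src d.tgt :=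
  ⟨PresentedTwoCat.mk (.whiskerLeft d.u (.whiskerRight (.gen d.α) d.v)),
    fun h => absurd h.size_eq_zero one_ne_zero⟩

/-! ### Local branchings -/

/-- The number of generating 1-cells in a 1-cell. -/
abbrev len {x y : S.FreeTrack} (f : x ⟶ y) : ℕ := Quiver.Path.length (V := S.cell₀) f

theorem len_comp {x y z : S.FreeTrack} (f : x ⟶ y) (g : y ⟶ z) : len (f ≫ g) = len f + len g :=
  Quiver.Path.length_comp (V := S.cell₀) f g

theorem exists_eq_comp_of_comp_eq_comp {a b c d : S.FreeTrack} {p : a ⟶ b} {q : b ⟶ d} {p' : a ⟶ c}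
    {q' : c ⟶ d} (h : p ≫ q = p' ≫ q') (hl : len p ≤ len p') :
    ∃ e : b ⟶ c, p' = p ≫ e ∧ q = e ≫ q' :=
  Quiver.Path.exists_eq_comp_of_comp_eq_comp (V := S.cell₀) h hl

namespace Step

variable {x y z : S.FreeTrack} {Γ : Set (TwoSphere S.FreeTrack)}

/-- Two steps with the same source are joinable when they can be completed by positive 2-cells into a
2-sphere that is filled by `Γ`. -/
def Joinable (Γ : Set (TwoSphere S.FreeTrack)) (d₁ d₂ : Step S x y) : Prop :=
  ∃ (h : d₁.src = d₂.src) (k : x ⟶ y) (A : d₁.tgt ⟶ k) (B : d₂.tgt ⟶ k), IsPositive A ∧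
    IsPositive B ∧ Homotopic Γ (d₁.cell ≫ A) (eqToHom h ≫ d₂.cell ≫ B)

namespace Joinable

variable {d₁ d₂ : Step S x y}

theorem symm (hd : Joinable Γ d₁ d₂) : Joinable Γ d₂ d₁ := by
  obtain ⟨h, k, A, B, hA, hB, H⟩ := hd
  refine ⟨h.symm, k, B, A, hB, hA, ?_⟩
  have := (Homotopic.refl (Γ := Γ) (eqToHom h.symm)).comp H.symm
  simpa using this

theorem wl (hd : Joinable Γ d₁ d₂) (w : z ⟶ x) : Joinable Γ (d₁.wl w) (d₂.wl w) := by
  obtain ⟨h, k, A, B, hA, hB, H⟩ := hd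
  refine ⟨by rw [src_wl, src_wl, h], w ≫ k, eqToHom (d₁.tgt_wl w) ≫ w ◁ A,
    eqToHom (d₂.tgt_wl w) ≫ w ◁ B, (IsPositive.eqToHom _).comp (hA.whiskerLeft w),
    (IsPositive.eqToHom _).comp (hB.whiskerLeft w), ?_⟩
  have := (Homotopic.refl (Γ := Γ) (eqToHom (d₁.src_wl w))).comp (H.whiskerLeft w)
  simpa [cell_wl, whiskerLeft_eqToHom] using this

theorem wr (hd : Joinable Γ d₁ d₂) (w : y ⟶ z) : Joinable Γ (d₁.wr w) (d₂.wr w) := by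
  obtain ⟨h, k, A, B, hA, hB, H⟩ := hd
  refine ⟨by rw [src_wr, src_wr, h], k ≫ w, eqToHom (d₁.tgt_wr w) ≫ A ▷ w,
    eqToHom (d₂.tgt_wr w) ≫ B ▷ w, (IsPositive.eqToHom _).comp (hA.whiskerRight w),
    (IsPositive.eqToHom _).comp (hB.whiskerRight w), ?_⟩
  have := (Homotopic.refl (Γ := Γ) (eqToHom (d₁.src_wr w))).comp (H.whiskerRight w)
  simpa [cell_wr, eqToHom_whiskerRight] using this

/-- Steps that apply to disjoint factors of a 1-cell commute, by the exchange law. -/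
theorem of_disjoint {p q p' q' : S.FreeTrack} (u : x ⟶ p) {s t : p ⟶ q} (α : S.cell₂ s t) (m : q ⟶ p')
    {s' t' : p' ⟶ q'} (β : S.cell₂ s' t') (v : q' ⟶ y) :
    Joinable Γ (⟨u, α, m ≫ s' ≫ v⟩ : Step S x y) ⟨u ≫ s ≫ m, β, v⟩ := by
  let d₁ : Step S x y := ⟨u ≫ t ≫ m, β, v⟩
  let d₂ : Step S x y := ⟨u, α, m ≫ t' ≫ v⟩
  refine ⟨by simp only [src, comp_assoc'], d₂.tgt,
    eqToHom (by simp only [src, comp_assoc', d₁]) ≫ d₁.cell ≫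
      eqToHom (by simp only [tgt, comp_assoc', d₁, d₂]),
    eqToHom (by simp only [src, tgt, comp_assoc', d₂]) ≫ d₂.cell,
    (IsPositive.eqToHom _).comp ((IsPositive.step _).comp (IsPositive.eqToHom _)),
    (IsPositive.eqToHom _).comp (IsPositive.step _), .of_eq ?_⟩
  have h₁ : d₁.cell = eqToHom (by simp only [src, comp_assoc', d₁]) ≫
      u ◁ t ◁ m ◁ (genCell β ▷ v) ≫ eqToHom (by simp only [tgt, comp_assoc', d₁]) := by
    change (u ≫ t ≫ m) ◁ (genCell β ▷ v) = _
    simp [Strict.associator_eqToIso, whiskerLeft_eqToHom]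
  have h₂ : (⟨u ≫ s ≫ m, β, v⟩ : Step S x y).cell = eqToHom (by simp only [src, comp_assoc']) ≫
      u ◁ s ◁ m ◁ (genCell β ▷ v) ≫ eqToHom (by simp only [tgt, comp_assoc']) := by
    change (u ≫ s ≫ m) ◁ (genCell β ▷ v) = _
    simp [Strict.associator_eqToIso, whiskerLeft_eqToHom]
  have h := congrArg (u ◁ ·) (whisker_exchange (genCell α) (m ◁ (genCell β ▷ v)))
  simp only [whiskerLeft_comp] at h
  rw [h₁, h₂]
  simp only [Category.assoc, eqToHom_trans, eqToHom_trans_assoc, eqToHom_refl, Category.id_comp,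
    Category.comp_id]
  exact h.symm

/-- Two overlapping steps are, up to a common context, steps whose source is at most as long as the
sources of their 2-cells together; hence joinability of short branchings gives that of all of them. -/
theorem of_short {L : ℕ} (hL : ∀ {p q : S.FreeTrack} {s t : p ⟶ q}, S.cell₂ s t → len s ≤ L)
    (hΓ : ∀ {x y : S.FreeTrack} (d₁ d₂ : Step S x y), d₁.src = d₂.src → len d₁.src ≤ 2 * L →
      Joinable Γ d₁ d₂) (d₁ d₂ : Step S x y) (h : d₁.src = d₂.src) : Joinable Γ d₁ d₂ := by
  wlog hle : len d₁.u ≤ len d₂.u generalizing d₁ d₂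
  · exact (this d₂ d₁ h.symm (Nat.le_of_not_le hle)).symm
  obtain ⟨u, α, v⟩ := d₁
  obtain ⟨u', β, v'⟩ := d₂
  rename_i p q s t p' q' s' t'
  change u ≫ s ≫ v = u' ≫ s' ≫ v' at h
  change len u ≤ len u' at hle
  obtain ⟨e, rfl, he⟩ := exists_eq_comp_of_comp_eq_comp h hle
  -- `β` applies either to the right of `s`, or to a factor that starts inside `s`.
  rcases Nat.le_total (len s) (len e) with hs | hs
  · obtain ⟨m, rfl, rfl⟩ := exists_eq_comp_of_comp_eq_comp he hs
    exact of_disjoint u α m β v'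
  · obtain ⟨s₁, rfl, hs₁⟩ := exists_eq_comp_of_comp_eq_comp he.symm hs
    have hα := hL α
    have hβ := hL β
    -- In the second case, the source of `β` either extends beyond `s` or is contained in it.
    rcases Nat.le_total (len s₁) (len s') with hs' | hs'
    · obtain ⟨s₂, rfl, rfl⟩ := exists_eq_comp_of_comp_eq_comp hs₁.symm hs'
      have H := hΓ ⟨𝟙 p, α, s₂⟩ ⟨e, β, 𝟙 q'⟩ (by simp only [src, id_comp', comp_id', comp_assoc'])
        (by simp only [src, id_comp', len_comp] at *; omega)
      have := (H.wl u).wr v'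
      simpa only [Step.wl, Step.wr, id_comp', comp_id'] using this
    · obtain ⟨w, rfl, rfl⟩ := exists_eq_comp_of_comp_eq_comp hs₁ hs'
      have H := hΓ ⟨𝟙 p, α, 𝟙 q⟩ ⟨e, β, w⟩ (by simp only [src, id_comp', comp_id'])
        (by simp only [src, id_comp', comp_id', len_comp] at *; omega)
      have := (H.wl u).wr v
      simpa only [Step.wl, Step.wr, id_comp', comp_id'] using this

end Joinable

end Step

/-! ### Finitely many short branchings -/

theorem IsFinite.finite_setOf_len_le (hS : S.IsFinite) (x y : S.FreeTrack) (n : ℕ) :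
    {f : x ⟶ y | len f ≤ n}.Finite := by
  have := hS.finite_cell₀
  have := hS.finite_cell₁
  have (a b : S.cell₀) : Finite (a ⟶ b) :=
    Finite.of_injective (β := Σ p q : S.cell₀, p ⟶ q) (fun e => ⟨a, b, e⟩) fun e e' h => by
      simpa using h
  exact Quiver.Path.finite_setOf_length_le (V := S.cell₀) x y n

theorem IsFinite.finite_setOf_step (hS : S.IsFinite) (x y : S.FreeTrack) (n : ℕ) :
    {d : Step S x y | len d.src ≤ n}.Finite := by
  have := hS.finite_cell₂
  let R := Σ (p q : S.cell₀) (f g : Quiver.Path p q), S.cell₂ f g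
  have : Finite R := this
  refine (Set.finite_iUnion fun r : R =>
    Set.Finite.image2 (fun (u : @Quiver.Hom S.FreeTrack _ x r.1) (v : @Quiver.Hom S.FreeTrack _ r.2.1 y) =>
      (⟨u, r.2.2.2.2, v⟩ : Step S x y)) (hS.finite_setOf_len_le _ _ n)
      (hS.finite_setOf_len_le _ _ n)).subset fun d hd => ?_
  change len d.src ≤ n at hd
  simp only [len_comp] at hd
  exact Set.mem_iUnion.2 ⟨⟨d.p, d.q, d.s, d.t, d.α⟩, d.u, show len d.u ≤ n by omega,
    d.v, show len d.v ≤ n by omega, rfl⟩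

theorem IsFinite.exists_len_le (hS : S.IsFinite) :
    ∃ L, ∀ {p q : S.FreeTrack} {s t : p ⟶ q}, S.cell₂ s t → len s ≤ L := by
  have := hS.finite_cell₂
  obtain ⟨L, hL⟩ := Finite.bddAbove_range
    fun r : Σ (p q : S.cell₀) (f g : Quiver.Path p q), S.cell₂ f g => r.2.2.1.length
  exact ⟨L, fun {p q s t} α => hL ⟨⟨p, q, s, t, α⟩, rfl⟩⟩

/-- A confluent branching of steps can be completed by positive 2-cells. -/
theorem IsConvergent.exists_isPositive (hS : S.IsConvergent) {x y : S.FreeTrack} (d₁ d₂ : Step S x y)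
    (h : d₁.src = d₂.src) :
    ∃ (k : x ⟶ y) (A : d₁.tgt ⟶ k) (B : d₂.tgt ⟶ k), IsPositive A ∧ IsPositive B := by
  obtain ⟨A, -⟩ := d₁.reduces
  obtain ⟨B, -⟩ := d₂.reduces
  rw [← h] at B
  obtain ⟨k, ⟨⟨A'⟩⟩, ⟨⟨B'⟩⟩⟩ := (hS x y d₁.src).2 A B
  obtain ⟨A'', hA⟩ := exists_isPositive_of_formalTwoCell (S := S) A'
  obtain ⟨B'', hB⟩ := exists_isPositive_of_formalTwoCell (S := S) B'
  exact ⟨k, A'', B'', hA, hB⟩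

/-- One confluence diagram for each of the finitely many pairs of steps whose common source has length
at most `n` makes all these pairs joinable. -/
theorem exists_finite_joinable (hfin : S.IsFinite) (hconv : S.IsConvergent) (n : ℕ) :
    ∃ Γ : Set (TwoSphere S.FreeTrack), Γ.Finite ∧ ∀ {x y : S.FreeTrack} (d₁ d₂ : Step S x y),
      d₁.src = d₂.src → len d₁.src ≤ n → d₁.Joinable Γ d₂ := by
  choose k A B hA hB using fun (x y : S.FreeTrack) (d₁ d₂ : Step S x y) (h : d₁.src = d₂.src) =>
    hconv.exists_isPositive d₁ d₂ h
  have : Finite S.FreeTrack := hfin.finite_cell₀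
  refine ⟨⋃ (x : S.FreeTrack) (y : S.FreeTrack), ⋃ d₁ ∈ {d : Step S x y | len d.src ≤ n},
    ⋃ d₂ ∈ {d : Step S x y | len d.src ≤ n}, ⋃ h : d₁.src = d₂.src,
      {⟨d₁.cell ≫ A x y d₁ d₂ h, eqToHom h ≫ d₂.cell ≫ B x y d₁ d₂ h⟩}, ?_, ?_⟩
  · exact Set.finite_iUnion fun x => Set.finite_iUnion fun y =>
      (hfin.finite_setOf_step x y n).biUnion fun d₁ _ =>
        (hfin.finite_setOf_step x y n).biUnion fun d₂ _ =>
          Set.finite_iUnion fun h => Set.finite_singleton _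
  · intro x y d₁ d₂ h hn
    refine ⟨h, k x y d₁ d₂ h, A x y d₁ d₂ h, B x y d₁ d₂ h, hA .., hB .., ⟨.gen ⟨_, _⟩ ?_⟩⟩
    simp only [Set.mem_iUnion]
    exact ⟨x, y, d₁, hn, d₂, show len d₂.src ≤ n from h ▸ hn, h, rfl⟩

/-! ### Normal forms -/

/-- The relation "`f` rewrites into `g` in one step", with the target first. -/
def RewritesTo (x y : S.FreeTrack) (g f : x ⟶ y) : Prop := ∃ d : Step S x y, d.src = f ∧ d.tgt = g

theorem IsConvergent.wellFounded (hS : S.IsConvergent) (x y : S.FreeTrack) :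
    WellFounded (RewritesTo (S := S) x y) := by
  refine wellFounded_iff_isEmpty_descending_chain.2 ⟨fun ⟨F, hF⟩ => ?_⟩
  refine (hS x y (F 0)).1 ⟨F, rfl, fun k => ?_⟩
  obtain ⟨d, h₁, h₂⟩ := hF k
  rw [← h₁, ← h₂]
  exact d.reduces

/-- A 1-cell is a normal form when no step applies to it. -/
def IsNormal {x y : S.FreeTrack} (f : x ⟶ y) : Prop := ∀ d : Step S x y, d.src ≠ f

theorem IsConvergent.exists_isNormal (hS : S.IsConvergent) {x y : S.FreeTrack} (f : x ⟶ y) :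
    ∃ (n : x ⟶ y) (A : f ⟶ n), IsPositive A ∧ IsNormal n := by
  induction f using (hS.wellFounded x y).induction with
  | _ f ih =>
    by_cases hf : IsNormal f
    · exact ⟨f, 𝟙 f, .id f, hf⟩
    · simp only [IsNormal, not_forall, not_not] at hf
      obtain ⟨d, rfl⟩ := hf
      obtain ⟨n, A, hA, hn⟩ := ih d.tgt ⟨d, rfl, rfl⟩
      exact ⟨n, _, hA.step_comp d, hn⟩

/-- Newman's lemma one dimension up: if all local branchings are joinable, then any two positive 2-cells from
a 1-cell to normal forms have the same target and are homotopic. -/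
theorem IsConvergent.homotopic_of_isNormal (hS : S.IsConvergent) {Γ : Set (TwoSphere S.FreeTrack)}
    {x y : S.FreeTrack}
    (hΓ : ∀ d₁ d₂ : Step S x y, d₁.src = d₂.src → d₁.Joinable Γ d₂) {f n m : x ⟶ y}
    {A : f ⟶ n} {B : f ⟶ m} (hA : IsPositive A) (hB : IsPositive B) (hn : IsNormal n) (hm : IsNormal m) :
    ∃ h : n = m, Homotopic Γ (A ≫ eqToHom h) B := by
  induction f using (hS.wellFounded x y).induction generalizing n m with
  | _ f ih =>
    rcases hA.exists_step_or_eq with ⟨rfl, rfl⟩ | ⟨d₁, rfl, A₁, hA₁, rfl⟩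
    · rcases hB.exists_step_or_eq with ⟨rfl, rfl⟩ | ⟨d, hd, -⟩
      · exact ⟨rfl, .of_eq (by simp)⟩
      · exact absurd hd.symm (hn d)
    rcases hB.exists_step_or_eq with ⟨hf, -⟩ | ⟨d₂, h, B₁, hB₁, rfl⟩
    · exact absurd hf (hm d₁)
    obtain ⟨_, k, A', B', hA', hB', H⟩ := hΓ d₁ d₂ h
    obtain ⟨l, C, hC, hl⟩ := hS.exists_isNormal k
    obtain ⟨rfl, H₁⟩ := ih d₁.tgt ⟨d₁, rfl, rfl⟩ hA₁ (hA'.comp hC) hn hl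
    obtain ⟨rfl, H₂⟩ := ih d₂.tgt ⟨d₂, h.symm, rfl⟩ hB₁ (hB'.comp hC) hm hl
    refine ⟨rfl, ?_⟩
    simp only [eqToHom_refl, Category.comp_id, Category.id_comp] at H₁ H₂ ⊢
    have H₃ := H.comp (Homotopic.refl C)
    simp only [Category.assoc] at H₃
    exact ((Homotopic.refl d₁.cell).comp H₁).trans
      (H₃.trans ((Homotopic.refl _).comp ((Homotopic.refl _).comp H₂.symm)))

/-! ### Homotopy bases from joinable branchings -/

/-- Induction on the 2-cells of the free track 2-category: they are generated by the 2-cells of `S` and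
their inverses under identities, composition and whiskering. -/
theorem freeTrack_induction
    {motive : ∀ {x y : S.FreeTrack} {f g : x ⟶ y}, (f ⟶ g) → Prop}
    (gen : ∀ {x y : S.FreeTrack} {f g : x ⟶ y} (α : S.cell₂ f g), motive (Step.genCell α))
    (inv : ∀ {x y : S.FreeTrack} {f g : x ⟶ y} (α : S.cell₂ f g), motive (Step.genInvCell α))
    (id : ∀ {x y : S.FreeTrack} (f : x ⟶ y), motive (𝟙 f))
    (comp : ∀ {x y : S.FreeTrack} {f g h : x ⟶ y} (A : f ⟶ g) (B : g ⟶ h), motive A → motive B →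
      motive (A ≫ B))
    (whiskerLeft : ∀ {x y z : S.FreeTrack} (f : x ⟶ y) {g h : y ⟶ z} (A : g ⟶ h), motive A →
      motive (f ◁ A))
    (whiskerRight : ∀ {x y z : S.FreeTrack} {f g : x ⟶ y} (A : f ⟶ g) (h : y ⟶ z), motive A →
      motive (A ▷ h))
    {x y : S.FreeTrack} {f g : x ⟶ y} : ∀ A : f ⟶ g, motive A := by
  refine Quotient.ind fun A => ?_
  induction A with
  | gen α =>
    rcases α with α | α
    · exact gen α
    · exact inv α
  | id f => exact id _
  | vcomp A B hA hB => exact comp _ _ hA hB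
  | whiskerLeft f A hA => exact whiskerLeft f _ hA
  | whiskerRight A h hA => exact whiskerRight _ h hA

/-- Every 2-cell `A : f ⇒ g` of the free track 2-category is compatible with normalisation: a positive
2-cell from `g` to a normal form, precomposed with `A`, is homotopic to a positive 2-cell. -/
theorem IsConvergent.exists_isPositive_homotopic (hS : S.IsConvergent)
    {Γ : Set (TwoSphere S.FreeTrack)}
    (hΓ : ∀ {x y : S.FreeTrack} (d₁ d₂ : Step S x y), d₁.src = d₂.src → d₁.Joinable Γ d₂)
    {x y : S.FreeTrack} {f g n : x ⟶ y} (A : f ⟶ g) {B : g ⟶ n} (hB : IsPositive B)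
    (hn : IsNormal n) : ∃ D : f ⟶ n, IsPositive D ∧ Homotopic Γ (A ≫ B) D := by
  induction A using freeTrack_induction with
  | gen α => exact ⟨_, (IsPositive.genCell α).comp hB, .refl _⟩
  | inv α =>
    -- The inverse of `α` cancels the first step of a positive 2-cell that starts with `α`.
    obtain ⟨m, D, hD, hm⟩ := hS.exists_isNormal _
    obtain ⟨rfl, H⟩ := hS.homotopic_of_isNormal hΓ hB ((IsPositive.genCell α).comp hD) hn hm
    refine ⟨D, hD, ?_⟩
    rw [eqToHom_refl, Category.comp_id] at H
    have := (Homotopic.refl (Step.genInvCell α)).comp H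
    rwa [← Category.assoc, Step.genInvCell_comp_genCell, Category.id_comp] at this
  | id f => exact ⟨B, hB, .of_eq (Category.id_comp B)⟩
  | comp A₁ A₂ ih₁ ih₂ =>
    obtain ⟨D₂, hD₂, H₂⟩ := ih₂ hB hn
    obtain ⟨D₁, hD₁, H₁⟩ := ih₁ hD₂ hn
    rw [Category.assoc]
    exact ⟨D₁, hD₁, ((Homotopic.refl A₁).comp H₂).trans H₁⟩
  | whiskerLeft f A ih =>
    -- The target of `f ◁ A` is normalised by normalising the target of `A` first.
    obtain ⟨m, E, hE, hm⟩ := hS.exists_isNormal _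
    obtain ⟨D, hD, H⟩ := ih hE hm
    obtain ⟨l, C, hC, hl⟩ := hS.exists_isNormal _
    obtain ⟨rfl, H'⟩ := hS.homotopic_of_isNormal hΓ hB ((hE.whiskerLeft f).comp hC) hn hl
    refine ⟨_, (hD.whiskerLeft f).comp hC, ?_⟩
    rw [eqToHom_refl, Category.comp_id] at H'
    refine ((Homotopic.refl _).comp H').trans ?_
    have := (H.whiskerLeft f).comp (Homotopic.refl C)
    rw [Bicategory.whiskerLeft_comp, Category.assoc] at this
    exact this
  | whiskerRight A h ih =>
    obtain ⟨m, E, hE, hm⟩ := hS.exists_isNormal _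
    obtain ⟨D, hD, H⟩ := ih hE hm
    obtain ⟨l, C, hC, hl⟩ := hS.exists_isNormal _
    obtain ⟨rfl, H'⟩ := hS.homotopic_of_isNormal hΓ hB ((hE.whiskerRight h).comp hC) hn hl
    refine ⟨_, (hD.whiskerRight h).comp hC, ?_⟩
    rw [eqToHom_refl, Category.comp_id] at H'
    refine ((Homotopic.refl _).comp H').trans ?_
    have := (H.whiskerRight h).comp (Homotopic.refl C)
    rw [Bicategory.comp_whiskerRight, Category.assoc] at this
    exact this

/-- In a convergent 2-polygraph, a set of 2-spheres that fills all local branchings is a homotopy basis. -/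
theorem IsConvergent.isHomotopyBasis (hS : S.IsConvergent) {Γ : Set (TwoSphere S.FreeTrack)}
    (hΓ : ∀ {x y : S.FreeTrack} (d₁ d₂ : Step S x y), d₁.src = d₂.src → d₁.Joinable Γ d₂) :
    IsHomotopyBasis Γ := by
  rintro ⟨A, B⟩
  obtain ⟨n, E, hE, hn⟩ := hS.exists_isNormal _
  obtain ⟨D₁, hD₁, H₁⟩ := hS.exists_isPositive_homotopic hΓ A hE hn
  obtain ⟨D₂, hD₂, H₂⟩ := hS.exists_isPositive_homotopic hΓ B hE hn
  obtain ⟨_, H⟩ := hS.homotopic_of_isNormal hΓ hD₁ hD₂ hn hn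
  rw [eqToHom_refl, Category.comp_id] at H
  have := hE.isIso
  simpa using ((H₁.trans H).trans H₂.symm).comp (Homotopic.refl (inv E))

end TwoPolygraph

theorem mainTheorem8 (S : TwoPolygraph.{u, v, w}) (hfin : S.IsFinite) (hconv : S.IsConvergent) :
    S.HasFiniteDerivationType := by
  obtain ⟨L, hL⟩ := hfin.exists_len_le
  obtain ⟨Γ, hΓ, h⟩ := TwoPolygraph.exists_finite_joinable hfin hconv (2 * L)
  exact ⟨hfin, Γ, hΓ, hconv.isHomotopyBasis (TwoPolygraph.Step.Joinable.of_short hL h)⟩
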